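/- Regard $\mathbb{Q}$ as a subgroup of $\mathbb{R}$. Let $G_{\mathbb{Q}}$ be the group of all homomorphisms $\chi:\mathbb{Q}\to\mathbb{T}$ into the circle group, with pointwise multiplication and the topology of pointwise convergence, and let $H_{\mathbb{Q}}=\{\,\mathbb{Q}\ni a\mapsto e^{iat}\in\mathbb{T} : t\in\mathbb{R}\,\}$, a subgroup of $G_{\mathbb{Q}}$ with the subspace topology. Let $(H_{\mathbb{Q}})^{\omega}$ be the product of countably infinitely many copies of $H_{\mathbb{Q}}$, with the product group structure and the product topology. All topological groups, including Lie groups and locally compact groups, are assumed to be Hausdorff. Then: 1. $(H_{\mathbb{Q}})^{\omega}$ is pre-locally compact, i.e. it is isomorphic as a topological group to a subgroup (with the subspace topology) of some locally compact group. 2. $(H_{\mathbb{Q}})^{\omega}$ is arcwise connected, i.e. any two distinct points are the end points of a homeomorphic copy of $[0,1]$. 3. $(H_{\mathbb{Q}})^{\omega}$ is not a virtual Lie group, i.e. there is no topology on it, finer than or equal to the given one, that makes it a connected (finite-dimensional, smooth) Lie group. 4. There is no topology on $(H_{\mathbb{Q}})^{\omega}$, finer than or equal to the given one, that makes it a connected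 locally compact group. -/

import Mathlib

open scoped Manifold ContDiff

/-- `G_A`: the group of all homomorphisms `A → 𝕋` from a subgroup `A` of `ℝ` to the circle group,
with pointwise multiplication. -/
def CharGroup (A : AddSubgroup ℝ) : Type := AddChar A Circle

namespace CharGroup

variable {A : AddSubgroup ℝ}

noncomputable instance : CommGroup (CharGroup A) := inferInstanceAs (CommGroup (AddChar A Circle))

instance : FunLike (CharGroup A) A Circle := inferInstanceAs (FunLike (AddChar A Circle) A Circle)

/-- The topology of pointwise convergence. -/
noncomputable instance : TopologicalSpace (CharGroup A) :=
  TopologicalSpace.induced (fun χ : CharGroup A => (χ : A → Circle)) inferInstance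

theorem mul_apply (χ ψ : CharGroup A) (a : A) : (χ * ψ) a = χ a * ψ a := rfl

theorem inv_apply (χ : CharGroup A) (a : A) : (χ⁻¹) a = (χ a)⁻¹ :=
  AddChar.inv_apply' (ψ := (χ : AddChar A Circle)) a

theorem isEmbedding_coe :
    Topology.IsEmbedding (fun χ : CharGroup A => (χ : A → Circle)) :=
  ⟨⟨rfl⟩, DFunLike.coe_injective⟩

instance : T2Space (CharGroup A) := isEmbedding_coe.t2Space

theorem continuous_apply (a : A) : Continuous (fun χ : CharGroup A => χ a) :=
  (_root_.continuous_apply a).comp isEmbedding_coe.continuous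

instance : IsTopologicalGroup (CharGroup A) where
  continuous_mul := isEmbedding_coe.continuous_iff.2 <| continuous_pi fun a =>
    ((continuous_apply a).comp continuous_fst).mul ((continuous_apply a).comp continuous_snd)
  continuous_inv := isEmbedding_coe.continuous_iff.2 <| continuous_pi fun a => by
    exact (continuous_inv.comp (continuous_apply a)).congr fun χ => (inv_apply χ a).symm

/-- For `t : ℝ`, the character `a ↦ e^{i a t}` of `A`. -/
noncomputable def expChar (A : AddSubgroup ℝ) (t : ℝ) : CharGroup A :=
  ({ toFun := fun a => Circle.exp ((a : ℝ) * t)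
     map_zero_eq_one' := by simp
     map_add_eq_mul' := fun a b => by simp [add_mul, Circle.exp_add] } : AddChar A Circle)

theorem expChar_apply (t : ℝ) (a : A) : expChar A t a = Circle.exp ((a : ℝ) * t) := rfl

end CharGroup

/-- `H_A`: the subgroup `{a ↦ e^{i a t} | t ∈ ℝ}` of `G_A`. -/
noncomputable def expCharSubgroup (A : AddSubgroup ℝ) : Subgroup (CharGroup A) where
  carrier := Set.range (CharGroup.expChar A)
  one_mem' := ⟨0, DFunLike.ext _ _ fun a => by
    rw [CharGroup.expChar_apply, mul_zero, Circle.exp_zero]; rfl⟩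
  mul_mem' := by
    rintro _ _ ⟨s, rfl⟩ ⟨t, rfl⟩
    exact ⟨s + t, DFunLike.ext _ _ fun a => by
      rw [CharGroup.mul_apply, CharGroup.expChar_apply, CharGroup.expChar_apply,
        CharGroup.expChar_apply, mul_add, Circle.exp_add]⟩
  inv_mem' := by
    rintro _ ⟨t, rfl⟩
    exact ⟨-t, DFunLike.ext _ _ fun a => by
      rw [CharGroup.inv_apply, CharGroup.expChar_apply, CharGroup.expChar_apply, mul_neg,
        Circle.exp_neg]⟩

/-- The rational numbers, as a subgroup of `ℝ`. -/
noncomputable def ratSubgroup : AddSubgroup ℝ := (Rat.castHom ℝ).toAddMonoidHom.range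

/-- `(H_ℚ)^ω`, which carries the product group structure and the product topology. -/
abbrev HQOmega : Type := ℕ → expCharSubgroup ratSubgroup

/-- A (Hausdorff) topological group is pre-locally compact if it is isomorphic, as a topological
group, to a subgroup of a (Hausdorff) locally compact group. -/
def IsPreLocallyCompact (H : Type) [Group H] [TopologicalSpace H] [IsTopologicalGroup H]
    [T2Space H] : Prop :=
  ∃ (G : Type) (_ : Group G) (_ : TopologicalSpace G),
    IsTopologicalGroup G ∧ T2Space G ∧ LocallyCompactSpace G ∧
      ∃ φ : H →* G, Topology.IsEmbedding φ

/-- Any two distinct points are the end points of an arc, a homeomorphic copy of `[0,1]`. -/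
def IsArcwiseConnected (X : Type) [TopologicalSpace X] : Prop :=
  Nonempty X ∧ ∀ x y : X, x ≠ y →
    ∃ γ : unitInterval → X, Topology.IsEmbedding γ ∧ γ 0 = x ∧ γ 1 = y

/-- `G`, with its given topology, is a connected Lie group: the topology is that of a connected
Hausdorff smooth manifold of some finite dimension for which multiplication and inversion are
smooth. -/
def IsConnectedLieGroup (G : Type) [Group G] [TopologicalSpace G] : Prop :=
  T2Space G ∧ ConnectedSpace G ∧
    ∃ (n : ℕ) (_ : ChartedSpace (EuclideanSpace ℝ (Fin n)) G), LieGroup (𝓡 n) ∞ G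

/-- `G`, with its given topology, is a connected locally compact (Hausdorff topological) group. -/
def IsConnectedLocallyCompactGroup (G : Type) [Group G] [TopologicalSpace G] : Prop :=
  IsTopologicalGroup G ∧ T2Space G ∧ LocallyCompactSpace G ∧ ConnectedSpace G

/-- A virtual Lie group: a topological group with a finer topology (not necessarily strictly finer;
in Mathlib, `τ' ≤ τ` says that `τ'` is finer) that makes it a connected Lie group. -/
def IsVirtualLieGroup (H : Type) [Group H] [τ : TopologicalSpace H] [IsTopologicalGroup H]
    [T2Space H] : Prop :=
  ∃ τ' : TopologicalSpace H, τ' ≤ τ ∧ @IsConnectedLieGroup H _ τ'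

/-- There is a finer topology making the group a connected locally compact group. -/
def AdmitsFinerConnectedLocallyCompact (H : Type) [Group H] [τ : TopologicalSpace H]
    [IsTopologicalGroup H] [T2Space H] : Prop :=
  ∃ τ' : TopologicalSpace H, τ' ≤ τ ∧ @IsConnectedLocallyCompactGroup H _ τ'

open Topology Set Filter
open scoped Pointwise

/-! Algebraically `H_ℚ` is `ℝ` with a coarser topology, so the power is `ℝ^ω` coarsened; it sits in
a power of the compact group `G_ℚ`, and line segments of `ℝ^ω` give arcs. A finer connected locally
compact topology would be Baire and σ-compact. Baire makes the real coordinates continuous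
(`continuous_ratExpEquiv_symm_comp`), so `ℝ^ω` would be a continuous image of a σ-compact space,
which Baire in `ℝ^ω` forbids. Lie groups are locally compact, so they are excluded too. -/

theorem CharGroup.isClosedEmbedding_coe (A : AddSubgroup ℝ) :
    IsClosedEmbedding (fun χ : CharGroup A => (χ : A → Circle)) := by
  refine ⟨isEmbedding_coe, ?_⟩
  have hrange : range (fun χ : CharGroup A => (χ : A → Circle)) =
      {f | f 0 = 1} ∩ ⋂ (a : A) (b : A), {f | f (a + b) = f a * f b} := by
    ext f
    simp only [mem_range, mem_inter_iff, mem_ofPred_eq, mem_iInter]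
    constructor
    · rintro ⟨χ, rfl⟩
      exact ⟨AddChar.map_zero_eq_one (χ : AddChar A Circle),
        AddChar.map_add_eq_mul (χ : AddChar A Circle)⟩
    · rintro ⟨h0, hadd⟩
      exact ⟨(⟨f, h0, hadd⟩ : AddChar A Circle), rfl⟩
  rw [hrange]
  refine (isClosed_eq (_root_.continuous_apply _) continuous_const).inter <|
    isClosed_iInter fun a => isClosed_iInter fun b =>
      isClosed_eq (_root_.continuous_apply _)
        ((_root_.continuous_apply a).mul (_root_.continuous_apply b))

instance (A : AddSubgroup ℝ) : CompactSpace (CharGroup A) :=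
  (CharGroup.isClosedEmbedding_coe A).compactSpace

theorem CharGroup.continuous_expChar (A : AddSubgroup ℝ) : Continuous (expChar A) :=
  isEmbedding_coe.continuous_iff.2 <| continuous_pi fun _ =>
    Circle.exp.continuous.comp (continuous_const.mul continuous_id)

theorem CharGroup.expChar_ratSubgroup_injective : Function.Injective (expChar ratSubgroup) := by
  intro s t hst
  -- Evaluating at `1/n` with `n > |s - t|` makes the phases differ by less than `1 < 2π`.
  obtain ⟨n, hn⟩ := exists_nat_gt |s - t|
  have hn0 : (0 : ℝ) < n := (abs_nonneg _).trans_lt hn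
  have hmem : (n : ℝ)⁻¹ ∈ ratSubgroup := ⟨(n : ℚ)⁻¹, by simp⟩
  have h : Circle.exp ((n : ℝ)⁻¹ * s) = Circle.exp ((n : ℝ)⁻¹ * t) :=
    DFunLike.congr_fun hst (⟨(n : ℝ)⁻¹, hmem⟩ : ratSubgroup)
  obtain ⟨m, hm⟩ := Circle.exp_eq_exp.1 h
  have hdiff : (n : ℝ)⁻¹ * (s - t) = m * (2 * Real.pi) := by linarith
  have hlt : |(m : ℝ)| * (2 * Real.pi) < 1 := by
    rw [← abs_of_pos Real.two_pi_pos, ← abs_mul, ← hdiff, abs_mul, abs_of_pos (inv_pos.2 hn0),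
      inv_mul_lt_iff₀ hn0]
    simpa using hn
  have hm0 : m = 0 := by
    by_contra hne
    have h1 : (1 : ℝ) ≤ |(m : ℝ)| := by exact_mod_cast Int.one_le_abs hne
    nlinarith [Real.pi_gt_three]
  rw [hm0, Int.cast_zero, zero_mul, add_zero] at hm
  exact mul_left_cancel₀ (inv_ne_zero hn0.ne') hm

/-- The one-parameter subgroup `t ↦ e^{i · t}`, as an algebraic isomorphism `ℝ ≃ H_ℚ`. -/
noncomputable def ratExpEquiv : Multiplicative ℝ ≃* expCharSubgroup ratSubgroup :=
  MulEquiv.ofBijective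
    (MonoidHom.mk' (fun t : Multiplicative ℝ => (⟨CharGroup.expChar ratSubgroup t.toAdd, t.toAdd, rfl⟩ : expCharSubgroup ratSubgroup))
      fun s t => Subtype.ext <| DFunLike.ext _ _ fun a => by
        simp only [Subgroup.coe_mul, CharGroup.mul_apply, CharGroup.expChar_apply, toAdd_mul,
          mul_add, Circle.exp_add])
    ⟨fun _ _ h => CharGroup.expChar_ratSubgroup_injective (congrArg Subtype.val h),
      fun ⟨_, t, ht⟩ => ⟨Multiplicative.ofAdd t, Subtype.ext ht⟩⟩

theorem continuous_ratExpEquiv : Continuous ratExpEquiv :=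
  Continuous.subtype_mk ((CharGroup.continuous_expChar _).comp continuous_toAdd) _

/-- A continuous bijection from a compact space to a Hausdorff space is a homeomorphism. -/
theorem continuousOn_ratExpEquiv_symm {K : Set (Multiplicative ℝ)} (hK : IsCompact K) :
    ContinuousOn ratExpEquiv.symm (ratExpEquiv '' K) := by
  refine continuousOn_iff_isClosed.2 fun Z hZ =>
    ⟨ratExpEquiv '' (K ∩ Z), ((hK.inter_right hZ).image continuous_ratExpEquiv).isClosed, ?_⟩
  ext y
  constructor
  · rintro ⟨hy, x, hx, rfl⟩
    exact ⟨⟨x, ⟨hx, by simpa using hy⟩, rfl⟩, x, hx, rfl⟩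
  · rintro ⟨⟨x, ⟨hx, hxZ⟩, rfl⟩, hy⟩
    exact ⟨by simpa using hxZ, hy⟩

/-- A continuous homomorphism from a Baire group to `H_ℚ` stays continuous for the finer topology
of `ℝ`. -/
theorem continuous_ratExpEquiv_symm_comp {G : Type*} [Group G] [TopologicalSpace G]
    [IsTopologicalGroup G] [BaireSpace G] (f : G →* expCharSubgroup ratSubgroup)
    (hf : Continuous f) : Continuous fun g => ratExpEquiv.symm (f g) := by
  let K : ℕ → Set (Multiplicative ℝ) := fun n => Multiplicative.toAdd ⁻¹' Icc (-n : ℝ) n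
  have hK (n : ℕ) : IsCompact (K n) := isCompact_Icc (a := (-n : ℝ)) (b := n)
  -- By Baire, `f` maps some open set into the image of one interval, where the inverse is
  -- continuous; translation carries continuity from `x` to `1`.
  obtain ⟨n, x, hx⟩ := nonempty_interior_of_iUnion_of_closed
    (f := fun n => f ⁻¹' (ratExpEquiv '' K n))
    (fun n => ((hK n).image continuous_ratExpEquiv).isClosed.preimage hf)
    (eq_univ_of_forall fun g => by
      obtain ⟨n, hn⟩ := exists_nat_ge |(ratExpEquiv.symm (f g)).toAdd|
      exact mem_iUnion.2 ⟨n, ratExpEquiv.symm (f g), abs_le.1 hn, by simp⟩)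
  have hcx : ContinuousAt (fun g => ratExpEquiv.symm (f g)) x :=
    ((continuousOn_ratExpEquiv_symm (hK n)).comp hf.continuousOn
      (mapsTo_preimage _ _)).continuousAt (mem_interior_iff_mem_nhds.1 hx)
  refine continuous_of_continuousAt_one (ratExpEquiv.symm.toMonoidHom.comp f) ?_
  have h1 : ContinuousAt (fun g => (ratExpEquiv.symm (f x))⁻¹ * ratExpEquiv.symm (f (x * g))) 1 :=
    continuousAt_const.mul <|
      ContinuousAt.comp (g := fun g => ratExpEquiv.symm (f g)) (f := fun g => x * g)
        (by simpa using hcx) (continuous_const_mul x).continuousAt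
  convert h1 using 2 with g
  simp

/-- The powers of a symmetric compact neighbourhood of `1` have a clopen union. -/
theorem sigmaCompactSpace_of_connected_group (G : Type*) [Group G] [TopologicalSpace G]
    [IsTopologicalGroup G] [LocallyCompactSpace G] [ConnectedSpace G] : SigmaCompactSpace G := by
  obtain ⟨L, hL, hL1⟩ := exists_compact_mem_nhds (1 : G)
  let K := L ∪ L⁻¹
  have hK : IsCompact K := hL.union hL.inv
  have hpow (n : ℕ) : IsCompact (K ^ n) := by
    induction n with
    | zero => simp
    | succ n ih => rw [pow_succ]; exact ih.mul hK
  have hnhds (x : G) : (fun g => x⁻¹ * g) ⁻¹' L ∈ 𝓝 x :=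
    (continuous_const_mul x⁻¹).continuousAt.preimage_mem_nhds (by simpa using hL1)
  have hclopen : IsClopen (⋃ n, K ^ n) := by
    constructor
    · refine isClosed_of_closure_subset fun x hx => ?_
      obtain ⟨y, hyL, hy⟩ := mem_closure_iff_nhds.1 hx _ (hnhds x)
      obtain ⟨n, hn⟩ := mem_iUnion.1 hy
      have hK' : (x⁻¹ * y)⁻¹ ∈ K := Or.inr (by simpa using hyL)
      have hx' := mul_mem_mul hn hK'
      rw [← pow_succ, mul_inv_rev, inv_inv, mul_inv_cancel_left] at hx'
      exact mem_iUnion.2 ⟨n + 1, hx'⟩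
    · refine isOpen_iff_mem_nhds.2 fun x hx => mem_of_superset (hnhds x) ?_
      intro y hy
      obtain ⟨n, hn⟩ := mem_iUnion.1 hx
      have hK' : x⁻¹ * y ∈ K := Or.inl hy
      have hy' := mul_mem_mul hn hK'
      rw [← pow_succ, mul_inv_cancel_left] at hy'
      exact mem_iUnion.2 ⟨n + 1, hy'⟩
  exact ⟨_, hpow, hclopen.eq_univ ⟨1, mem_iUnion.2 ⟨0, by simp⟩⟩⟩

/-- A compact subset of `ℝ^ω` has empty interior. -/
theorem interior_eq_empty_of_isCompact_pi_real {K : Set (ℕ → ℝ)} (hK : IsCompact K) :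
    interior K = ∅ := by
  refine eq_empty_iff_forall_notMem.2 fun x hx => ?_
  rw [mem_interior_iff_mem_nhds, nhds_pi, Filter.mem_pi] at hx
  obtain ⟨I, hI, t, ht, hsub⟩ := hx
  -- A basic neighbourhood leaves some coordinate `j` free, so `K` would project onto all of `ℝ`.
  obtain ⟨j, hj⟩ := hI.exists_notMem
  have hsurj : (fun f : ℕ → ℝ => f j) '' K = univ := eq_univ_of_forall fun r => by
    refine ⟨Function.update x j r, hsub fun i hi => ?_, by simp⟩
    rw [Function.update_of_ne (ne_of_mem_of_not_mem hi hj)]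
    exact mem_of_mem_nhds (ht i)
  exact noncompact_univ ℝ (hsurj ▸ hK.image (_root_.continuous_apply j))

theorem not_admitsFinerConnectedLocallyCompact_HQOmega :
    ¬ AdmitsFinerConnectedLocallyCompact HQOmega := by
  rintro ⟨τ, hτ, hgroup, hT2, hlc, hconn⟩
  have hcoord (i : ℕ) : @Continuous HQOmega (Multiplicative ℝ) τ _
      fun h => ratExpEquiv.symm (h i) :=
    @continuous_ratExpEquiv_symm_comp HQOmega _ τ hgroup inferInstance
      (Pi.evalMonoidHom _ i) (continuous_le_dom hτ (_root_.continuous_apply i))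
  let F : HQOmega → ℕ → ℝ := fun h i => (ratExpEquiv.symm (h i)).toAdd
  have hF : @Continuous HQOmega (ℕ → ℝ) τ _ F :=
    @continuous_pi _ _ _ τ _ _ fun i => continuous_toAdd.comp (hcoord i)
  have hsurj : Function.Surjective F := fun v =>
    ⟨fun i => ratExpEquiv (Multiplicative.ofAdd (v i)), by simp [F]⟩
  have hsigma := @sigmaCompactSpace_of_connected_group HQOmega _ τ hgroup hlc hconn
  have hcompact (n : ℕ) : IsCompact (F '' @compactCovering HQOmega τ hsigma n) :=
    @IsCompact.image _ _ τ _ _ _ (@isCompact_compactCovering HQOmega τ hsigma n) hF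
  obtain ⟨n, hn⟩ := nonempty_interior_of_iUnion_of_closed (fun n => (hcompact n).isClosed) (by
    rw [← image_iUnion, @iUnion_compactCovering HQOmega τ hsigma, image_univ, hsurj.range_eq])
  rw [interior_eq_empty_of_isCompact_pi_real (hcompact n)] at hn
  exact not_nonempty_empty hn

theorem IsVirtualLieGroup.admitsFinerConnectedLocallyCompact {H : Type} [Group H]
    [TopologicalSpace H] [IsTopologicalGroup H] [T2Space H] (h : IsVirtualLieGroup H) :
    AdmitsFinerConnectedLocallyCompact H := by
  obtain ⟨τ, hτ, hT2, hconn, n, hcharted, hLie⟩ := h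
  exact ⟨τ, hτ, @topologicalGroup_of_lieGroup _ _ _ _ _ _ _ (𝓡 n) ∞ H τ hcharted _ hLie, hT2,
    @ChartedSpace.locallyCompactSpace (EuclideanSpace ℝ (Fin n)) H _ τ hcharted _, hconn⟩

theorem isPreLocallyCompact_HQOmega : IsPreLocallyCompact HQOmega :=
  ⟨ℕ → CharGroup ratSubgroup, inferInstance, inferInstance, inferInstance, inferInstance,
    inferInstance, MonoidHom.pi fun i => (Subgroup.subtype _).comp (Pi.evalMonoidHom _ i),
    IsEmbedding.piMap fun _ => IsEmbedding.subtypeVal⟩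

theorem isArcwiseConnected_HQOmega : IsArcwiseConnected HQOmega := by
  refine ⟨⟨1⟩, fun x y hxy => ?_⟩
  let log (h : HQOmega) (i : ℕ) : ℝ := (ratExpEquiv.symm (h i)).toAdd
  let γ : unitInterval → HQOmega := fun s i =>
    ratExpEquiv (Multiplicative.ofAdd (log x i + s * (log y i - log x i)))
  have hγ : Continuous γ := continuous_pi fun i =>
    continuous_ratExpEquiv.comp (continuous_ofAdd.comp (by fun_prop))
  -- One coordinate where `x` and `y` differ already makes the segment injective.
  obtain ⟨i, hi⟩ := Function.ne_iff.1 hxy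
  have hne : log y i - log x i ≠ 0 := fun h =>
    hi (ratExpEquiv.symm.injective (Multiplicative.toAdd.injective (sub_eq_zero.1 h).symm))
  have hinj : Function.Injective γ := fun s t hst => by
    have h := Multiplicative.ofAdd.injective (ratExpEquiv.injective (congrFun hst i))
    exact Subtype.ext (mul_right_cancel₀ hne (add_left_cancel h))
  exact ⟨γ, (hγ.isClosedEmbedding hinj).isEmbedding, by ext1 j; simp [γ, log],
    by ext1 j; simp [γ, log]⟩

theorem mainTheorem8 :
    IsPreLocallyCompact HQOmega ∧
    IsArcwiseConnected HQOmega ∧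
    ¬ IsVirtualLieGroup HQOmega ∧
    ¬ AdmitsFinerConnectedLocallyCompact HQOmega :=
  ⟨isPreLocallyCompact_HQOmega, isArcwiseConnected_HQOmega,
    fun h => not_admitsFinerConnectedLocallyCompact_HQOmega h.admitsFinerConnectedLocallyCompact,
    not_admitsFinerConnectedLocallyCompact_HQOmega⟩
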